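/- Let $\mathbb{N}=\{1,2,3,\dots\}$. A *system* $(X,T)$ is a nonempty compact metric space $(X,d)$ with a continuous map $T:X\to X$; it is *minimal* if the only nonempty closed set $Y\subseteq X$ with $TY\subseteq Y$ is $X$. For $x\in X$ and $U\subseteq X$ write $R(x,U)=\{n\in\mathbb{N} : T^n x\in U\}$. For $A\subseteq\mathbb{N}$ and $k\in\mathbb{N}$ write $A-k=\{m\in\mathbb{N}: m+k\in A\}$ and $A+k=\{a+k : a\in A\}$. A set $A\subseteq\mathbb{N}$ is called - *syndetic* if $A\cup(A-1)\cup\dots\cup(A-N)=\mathbb{N}$ for some $N\in\mathbb{N}$; *thick* if for every finite $F\subseteq\mathbb{N}$ there is $n\in\mathbb{N}$ with $F+n\subseteq A$; *piecewise syndetic* if $A\cup(A-1)\cup\dots\cup(A-N)$ is thick for some $N\in\mathbb{N}$; - *central* if there are a system $(X,T)$, a point $x\in X$ that is uniformly recurrent (that is, $R(x,V)$ is syndetic for every open $V\ni x$), a point $y\in X$ proximal to $x$ (that is, $\inf_{n\in\mathbb{N}} d(T^n x,T^n y)=0$), and an open set $U\ni x$ such that $A=R(y,U)$; - *dynamically syndetic*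 (resp. *dynamically central syndetic*) if there are a minimal system $(X,T)$, a point $x\in X$ and a nonempty open set $U\subseteq X$ (resp. an open set $U\subseteq X$ with $x\in U$) such that $R(x,U)\subseteq A$; - *dynamically thick* (resp. a *set of pointwise recurrence*) if for all minimal systems $(X,T)$, all $x\in X$ and all nonempty open $U\subseteq X$ (resp. all open $U\subseteq X$ with $x\in U$) there is $n\in A$ with $T^n x\in U$; - *dynamically piecewise syndetic* if $A=B\cap C$ with $B$ dynamically syndetic and $C$ dynamically thick; - *dynamically central piecewise syndetic* if $A=B\cap C$ with $B$ dynamically central syndetic and $C$ a set of pointwise recurrence. Denote by $\mathcal{C}$, $\mathcal{PS}$, $d\mathcal{PS}$ and $dc\mathcal{PS}$ the families of central, piecewise syndetic, dynamically piecewise syndetic, and dynamically central piecewise syndetic subsets of $\mathbb{N}$, respectively. Then $$\mathcal{C}\subsetneq dc\mathcal{PS}\subsetneq d\mathcal{PS}=\mathcal{PS}.$$ In particular, a set is dynamically piecewise syndetic if and only if it is piecewise syndetic; thus the intersection of a dynamically syndetic set with a dynamically thick set is piecewise syndetic. -/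

import Mathlib

/-! The positive integers are `ℕ+`.  A topological dynamical system is a nonempty compact metric
space `X` with a continuous self-map `T`.  A compact metric space has at most continuum many points,
so every system is isomorphic to one whose space lives in `Type`. -/

namespace PointRec

/-! ### Syndetic, thick and piecewise syndetic sets -/

/-- The set `A ∪ (A - 1) ∪ ⋯ ∪ (A - N)`, where `A - k = {m ∈ ℕ+ | m + k ∈ A}`. -/
def unionShifts (A : Set ℕ+) (N : ℕ+) : Set ℕ+ :=
  {m | m ∈ A ∨ ∃ k : ℕ+, k ≤ N ∧ m + k ∈ A}

/-- `A` is syndetic: finitely many of its shifts cover the positive integers. -/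
def IsSyndetic (A : Set ℕ+) : Prop :=
  ∃ N : ℕ+, unionShifts A N = Set.univ

/-- `A` is thick: it contains a translate of every finite set. -/
def IsThick (A : Set ℕ+) : Prop :=
  ∀ F : Finset ℕ+, ∃ n : ℕ+, ∀ f ∈ F, f + n ∈ A

/-- `A` is piecewise syndetic: the union of finitely many of its shifts is thick. -/
def IsPiecewiseSyndetic (A : Set ℕ+) : Prop :=
  ∃ N : ℕ+, IsThick (unionShifts A N)

/-! ### Topological dynamics -/

/-- `R(x, U)`, the set of times `n ≥ 1` at which the point `x` visits `U`. -/
def returnTimes {X : Type} (T : X → X) (x : X) (U : Set X) : Set ℕ+ :=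
  {n | T^[(n : ℕ)] x ∈ U}

/-- The system `(X, T)` is minimal: `X` is its only nonempty, closed, `T`-invariant subset. -/
def IsMinimalSystem {X : Type} [MetricSpace X] [CompactSpace X] (T : X → X) : Prop :=
  Nonempty X ∧ Continuous T ∧
    ∀ Y : Set X, Y.Nonempty → IsClosed Y → Set.MapsTo T Y Y → Y = Set.univ

/-- The point `x` is uniformly recurrent: it returns syndetically often to each of its
neighborhoods. -/
def IsUniformlyRecurrent {X : Type} [MetricSpace X] (T : X → X) (x : X) : Prop :=
  ∀ U : Set X, IsOpen U → x ∈ U → IsSyndetic (returnTimes T x U)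

/-- The points `x` and `y` are proximal. -/
def IsProximal {X : Type} [MetricSpace X] (T : X → X) (x y : X) : Prop :=
  ⨅ n : ℕ+, dist (T^[(n : ℕ)] x) (T^[(n : ℕ)] y) = 0

/-! ### Families defined by dynamics -/

/-- `A` is central (in the sense of Furstenberg). -/
def IsCentral (A : Set ℕ+) : Prop :=
  ∃ (X : Type) (_ : MetricSpace X) (_ : CompactSpace X) (T : X → X) (x y : X) (U : Set X),
    Continuous T ∧ IsUniformlyRecurrent T x ∧ IsProximal T y x ∧ IsOpen U ∧ x ∈ U ∧
      A = returnTimes T y U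

/-- `A` is dynamically syndetic. -/
def IsDynSyndetic (A : Set ℕ+) : Prop :=
  ∃ (X : Type) (_ : MetricSpace X) (_ : CompactSpace X) (T : X → X) (x : X) (U : Set X),
    IsMinimalSystem T ∧ IsOpen U ∧ U.Nonempty ∧ returnTimes T x U ⊆ A

/-- `A` is dynamically central syndetic. -/
def IsDynCentralSyndetic (A : Set ℕ+) : Prop :=
  ∃ (X : Type) (_ : MetricSpace X) (_ : CompactSpace X) (T : X → X) (x : X) (U : Set X),
    IsMinimalSystem T ∧ IsOpen U ∧ x ∈ U ∧ returnTimes T x U ⊆ A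

/-- `A` is dynamically thick. -/
def IsDynThick (A : Set ℕ+) : Prop :=
  ∀ (X : Type) [MetricSpace X] [CompactSpace X] (T : X → X), IsMinimalSystem T →
    ∀ (x : X) (U : Set X), IsOpen U → U.Nonempty → ∃ n ∈ A, T^[(n : ℕ)] x ∈ U

/-- `A` is a set of (minimal, topological) pointwise recurrence. -/
def IsSetOfPointwiseRecurrence (A : Set ℕ+) : Prop :=
  ∀ (X : Type) [MetricSpace X] [CompactSpace X] (T : X → X), IsMinimalSystem T →
    ∀ (x : X) (U : Set X), IsOpen U → x ∈ U → ∃ n ∈ A, T^[(n : ℕ)] x ∈ U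

/-- `A` is dynamically piecewise syndetic. -/
def IsDynPiecewiseSyndetic (A : Set ℕ+) : Prop :=
  ∃ B C : Set ℕ+, IsDynSyndetic B ∧ IsDynThick C ∧ A = B ∩ C

/-- `A` is dynamically central piecewise syndetic. -/
def IsDynCentralPiecewiseSyndetic (A : Set ℕ+) : Prop :=
  ∃ B C : Set ℕ+, IsDynCentralSyndetic B ∧ IsSetOfPointwiseRecurrence C ∧ A = B ∩ C

/-! ### The four families -/

/-- The family of central sets. -/
def centralSets : Set (Set ℕ+) := {A | IsCentral A}

/-- The family of piecewise syndetic sets. -/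
def piecewiseSyndeticSets : Set (Set ℕ+) := {A | IsPiecewiseSyndetic A}

/-- The family of dynamically piecewise syndetic sets. -/
def dynPiecewiseSyndeticSets : Set (Set ℕ+) := {A | IsDynPiecewiseSyndetic A}

/-- The family of dynamically central piecewise syndetic sets. -/
def dynCentralPiecewiseSyndeticSets : Set (Set ℕ+) := {A | IsDynCentralPiecewiseSyndetic A}

end PointRec

namespace PointRec


/-! The engine is a combinatorial criterion, `exists_recurrent_subset`: if every finite piece of `S
∪ {m}` can be translated into `S` at a syndetic set of places, then `S ∪ {m}` contains the support
of a uniformly recurrent 0-1 sequence with a one at `m`. The orbit closure of that sequence under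
the shift is minimal, so its visits to `{w | w 0 = true}` show that `S` is dynamically central
syndetic (`m = 0`) or dynamically syndetic (`m ∈ S`).

Suppose `R(x, U) ⊆ B` and `B ∩ C` is not piecewise syndetic. Its complement `D` contains arbitrarily
long intervals with bounded gaps, so by uniform recurrence `R(x, U) ∩ D` meets the criterion. Then
`C` must meet `R(x, U) ∩ D`, which is impossible because `R(x, U) ∩ C ⊆ B ∩ C`. This handles both
dynamical families.

Conversely, for `A` piecewise syndetic, the orbit closure of its indicator contains a minimal set in
which ones have bounded gaps. An idempotent ultrafilter gives a point `y` of that set proximal to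
the indicator; the visits of `y` are dynamically syndetic, and the times at which the two sequences
agree form a thick set. Central sets likewise contain the intersection of a dynamically central
syndetic set with a thick one.

The inclusions are strict. The set of `n` with the 2-adic valuation of `⌊√n⌋` is a set of pointwise
recurrence, but on long intervals it has constant valuation, which return times of a uniformly
recurrent point do not allow. The odd numbers are syndetic, yet every `R(x, U)` with `x ∈ U`
contains a dynamically central syndetic set of even numbers. -/

/-! ### Uniformly recurrent 0-1 sequences with prescribed support -/

/-- The word `W` of length `L` (given by the set of its ones) occurs in `u` at `s`, inside
`[a, b)`. -/
def OccursAt (W : Set ℕ) (L a b : ℕ) (u : Set ℕ) (s : ℕ) : Prop :=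
  a ≤ s ∧ s + L ≤ b ∧ ∀ i < L, (s + i ∈ u ↔ i ∈ W)

/-- From every position of `[a, b]` one gets, within distance `K`, to an occurrence of the word `W`
or to the end `b`, unless the position is already covered by such an occurrence. -/
def IsTight (c : Set ℕ × ℕ × ℕ) (a b : ℕ) (u : Set ℕ) : Prop :=
  ∀ t, a ≤ t → t ≤ b → ∃ s, (s = b ∨ OccursAt c.1 c.2.1 a b u s) ∧ t < s + c.2.1 ∧ s ≤ t + c.2.2

theorem OccursAt.union_left {W u v : Set ℕ} {L a b d s : ℕ} (h : OccursAt W L a b u s)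
    (hbd : b ≤ d) (hv : v ⊆ Set.Ico b d) : OccursAt W L a d (u ∪ v) s := by
  refine ⟨h.1, h.2.1.trans hbd, fun i hi => ?_⟩
  rw [← h.2.2 i hi]
  constructor
  · rintro (h1 | h1)
    · exact h1
    · have := (hv h1).1; have := h.2.1; omega
  · exact Or.inl

theorem OccursAt.union_right {W u v : Set ℕ} {L a b d s : ℕ} (h : OccursAt W L b d v s)
    (hab : a ≤ b) (hu : u ⊆ Set.Ico a b) : OccursAt W L a d (u ∪ v) s := by
  refine ⟨hab.trans h.1, h.2.1, fun i hi => ?_⟩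
  rw [← h.2.2 i hi]
  constructor
  · rintro (h1 | h1)
    · have := (hu h1).2; have := h.1; omega
    · exact h1
  · exact Or.inr

/-- The only danger is a position of `u` whose witness is the end `b`, which is no longer an end. A
word starting at `b` replaces it directly. A word ending at `b` either lies ahead or covers the
position, which is why tightness accepts covering occurrences. -/
theorem IsTight.union {c : Set ℕ × ℕ × ℕ} {a b d : ℕ} {u v : Set ℕ} (hL : 0 < c.2.1)
    (hab : a ≤ b) (hbd : b ≤ d)
    (hu : IsTight c a b u) (hv : IsTight c b d v) (hua : u ⊆ Set.Ico a b) (hva : v ⊆ Set.Ico b d)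
    (h : OccursAt c.1 c.2.1 b d v b ∨ ∃ s, s + c.2.1 = b ∧ OccursAt c.1 c.2.1 a b u s) :
    IsTight c a d (u ∪ v) := by
  intro t hat htd
  rcases le_or_gt b t with hbt | htb
  · obtain ⟨s, hs, h1, h2⟩ := hv t hbt htd
    exact ⟨s, hs.imp_right fun o => o.union_right hab hua, h1, h2⟩
  · obtain ⟨s, hs | hs, h1, h2⟩ := hu t hat htb.le
    · subst hs
      rcases h with h | ⟨s', hs', h⟩
      · exact ⟨s, Or.inr (h.union_right hab hua), h1, h2⟩
      · exact ⟨s', Or.inr (h.union_left hbd hva), by omega, by omega⟩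
    · exact ⟨s, Or.inr (hs.union_left hbd hva), h1, h2⟩

theorem isTight_of_short {c : Set ℕ × ℕ × ℕ} {a b : ℕ} {u : Set ℕ} (hL : 0 < c.2.1)
    (h : b ≤ a + c.2.2) : IsTight c a b u := fun t _ _ => ⟨b, Or.inl rfl, by omega, by omega⟩

/-- The translate of a word to position `q`. -/
def translate (q : ℕ) (W : Set ℕ) : Set ℕ := {n | q ≤ n ∧ n - q ∈ W}

theorem add_mem_translate {q i : ℕ} {W : Set ℕ} : q + i ∈ translate q W ↔ i ∈ W := by
  simp [translate]

theorem translate_subset_Ico {q L : ℕ} {W : Set ℕ} (h : W ⊆ Set.Ico 0 L) :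
    translate q W ⊆ Set.Ico q (q + L) := by
  rintro n ⟨h1, h2⟩
  have := (h h2).2
  exact ⟨h1, by omega⟩

theorem OccursAt.translate {W u : Set ℕ} {L b s : ℕ} (q : ℕ) (h : OccursAt W L 0 b u s) :
    OccursAt W L q (q + b) (translate q u) (q + s) := by
  refine ⟨by omega, by have := h.2.1; omega, fun i hi => ?_⟩
  rw [add_assoc, add_mem_translate, h.2.2 i hi]

theorem IsTight.translate {c : Set ℕ × ℕ × ℕ} {b : ℕ} {u : Set ℕ} (q : ℕ)
    (h : IsTight c 0 b u) : IsTight c q (q + b) (translate q u) := by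
  intro t h1 h2
  obtain ⟨s, hs, h3, h4⟩ := h (t - q) (by omega) (by omega)
  exact ⟨q + s, hs.imp (by omega) (fun o => o.translate q), by omega, by omega⟩

theorem occursAt_self (W : Set ℕ) (L : ℕ) : OccursAt W L 0 L W 0 := by
  refine ⟨le_rfl, by omega, fun i _ => by simp⟩

theorem isTight_self {W : Set ℕ} {L K : ℕ} (hL : 0 < L) : IsTight (W, L, K) 0 L W := by
  intro t _ h2
  rcases h2.lt_or_eq with h | h
  · exact ⟨0, Or.inr (occursAt_self W L), by simpa using h, by simp⟩
  · exact ⟨L, Or.inl rfl, by simp; omega, by simp; omega⟩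

/-- Every interval has a filling with ones in `S` that is tight for all words of `F`. -/
def IsFillable (S : Set ℕ) (F : Set (Set ℕ × ℕ × ℕ)) : Prop :=
  ∀ a b, a ≤ b → ∃ u ⊆ S ∩ Set.Ico a b, ∀ c ∈ F, IsTight c a b u

/-- The times at which a word of length `L` with ones in `S'` may be copied, with ones in `S`. -/
def copyTimes (S S' : Set ℕ) (L : ℕ) : Set ℕ := {q | ∀ i < L, i ∈ S' → q + i ∈ S}

/-- `(W, L)` is a legal word, compatible with the earlier words listed in `F`. -/
structure IsStage (S S' : Set ℕ) (F : Set (Set ℕ × ℕ × ℕ)) (W : Set ℕ) (L : ℕ) : Prop where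
  pos : 0 < L
  subset : W ⊆ S' ∩ Set.Ico 0 L
  fillable : IsFillable S F
  pos_of_mem : ∀ c ∈ F, 0 < c.2.1
  tight : ∀ c ∈ F, IsTight c 0 L W
  starts : ∀ c ∈ F, OccursAt c.1 c.2.1 0 L W 0
  ends : ∀ c ∈ F, ∃ s, s + c.2.1 = L ∧ OccursAt c.1 c.2.1 0 L W s

/-- Greedy filling: find a copy time `q` in `[a, a + K]`, fill `[a, q)` using the earlier words,
copy `W` at `q`, and recurse on the rest. The junctions are harmless because `W` starts and ends
with every earlier word. -/
theorem IsStage.isFillable_insert {S S' : Set ℕ} {F : Set (Set ℕ × ℕ × ℕ)} {W : Set ℕ} {L K : ℕ}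
    (h : IsStage S S' F W L) (hK : ∀ t, ∃ q ∈ copyTimes S S' L, t ≤ q ∧ q ≤ t + K) :
    IsFillable S (insert (W, L, K + L) F) := by
  intro a b hab
  induction hn : b - a using Nat.strong_induction_on generalizing a with
  | _ n ih =>
  subst hn
  obtain ⟨q, hq, haq, hqK⟩ := hK a
  have hL := h.pos
  by_cases hqb : q + L ≤ b
  · obtain ⟨u, hu, hut⟩ := h.fillable a q haq
    obtain ⟨v, hv, hvt⟩ := ih (b - (q + L)) (by omega) (q + L) hqb rfl
    have hW : W ⊆ Set.Ico 0 L := fun x hx => (h.subset hx).2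
    have hu' : u ⊆ Set.Ico a q := fun x hx => (hu hx).2
    have hv' : v ⊆ Set.Ico (q + L) b := fun x hx => (hv hx).2
    have hT := translate_subset_Ico (q := q) hW
    have huT : u ∪ translate q W ⊆ Set.Ico a (q + L) := by
      rintro x (hx | hx)
      · have := hu' hx; simp at this ⊢; omega
      · have := hT hx; simp at this ⊢; omega
    refine ⟨(u ∪ translate q W) ∪ v, ?_, ?_⟩
    · rintro x (hx | hx)
      · refine ⟨?_, ?_⟩
        · rcases hx with hx | hx
          · exact (hu hx).1
          · obtain ⟨h1, h2⟩ := hx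
            have := hq (x - q) (h.subset h2).2.2 (h.subset h2).1
            rwa [Nat.add_sub_cancel' h1] at this
        · have := huT hx; simp at this ⊢; omega
      · have := hv' hx
        exact ⟨(hv hx).1, by simp at this ⊢; omega⟩
    · rintro c (rfl | hc)
      · have hself : OccursAt W L q (q + L) (translate q W) q := (occursAt_self W L).translate q
        refine IsTight.union hL (by omega) hqb ?_ (hvt _ (Or.inl rfl)) huT hv' ?_
        · exact IsTight.union hL haq (by omega) (isTight_of_short hL (by simp; omega))
            ((isTight_self hL).translate q) hu' hT (Or.inl hself)
        · exact Or.inr ⟨q, rfl, hself.union_right haq hu'⟩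
      · have hc0 := h.pos_of_mem c hc
        obtain ⟨s, hs, hso⟩ := h.ends c hc
        refine IsTight.union hc0 (by omega) hqb ?_ (hvt _ (Or.inr hc)) huT hv' ?_
        · exact IsTight.union hc0 haq (by omega) (hut c hc) ((h.tight c hc).translate q) hu' hT
            (Or.inl ((h.starts c hc).translate q))
        · exact Or.inr ⟨q + s, by omega, (hso.translate q).union_right haq hu'⟩
  -- No room for a copy of `W`: then `b - a < K + L`, so the gap `K + L` makes tightness for `W`
  -- automatic.
  · obtain ⟨u, hu, hut⟩ := h.fillable a b hab
    refine ⟨u, hu, ?_⟩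
    rintro c (rfl | hc)
    · exact isTight_of_short hL (by simp; omega)
    · exact hut c hc

/-- The next word is `W`, a filling, and a second copy of `W`. It thus starts and ends with `W`,
hence with all earlier words. Only the initial `W` may use ones outside `S`. -/
theorem IsStage.exists_next {S S' : Set ℕ} {F : Set (Set ℕ × ℕ × ℕ)} {W : Set ℕ} {L K : ℕ}
    (hS : S ⊆ S') (h : IsStage S S' F W L)
    (hK : ∀ t, ∃ q ∈ copyTimes S S' L, t ≤ q ∧ q ≤ t + K) :
    ∃ W' L', IsStage S S' (insert (W, L, K + L) F) W' L' ∧ L < L' ∧ ∀ i < L, (i ∈ W' ↔ i ∈ W) := by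
  obtain ⟨q, hq, hLq, hqK⟩ := hK L
  obtain ⟨u, hu, hut⟩ := h.fillable L q hLq
  have hL := h.pos
  have hW : W ⊆ Set.Ico 0 L := fun x hx => (h.subset hx).2
  have hu' : u ⊆ Set.Ico L q := fun x hx => (hu hx).2
  have hT := translate_subset_Ico (q := q) hW
  have hWu : W ∪ u ⊆ Set.Ico 0 q := by
    rintro x (hx | hx)
    · have := hW hx; simp at this ⊢; omega
    · have := hu' hx; simp at this ⊢; omega
  have key : ∀ c : Set ℕ × ℕ × ℕ, 0 < c.2.1 → IsTight c 0 L W → IsTight c L q u →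
      OccursAt c.1 c.2.1 0 L W 0 → (∃ s, s + c.2.1 = L ∧ OccursAt c.1 c.2.1 0 L W s) →
      IsTight c 0 (q + L) (W ∪ u ∪ translate q W) ∧
      OccursAt c.1 c.2.1 0 (q + L) (W ∪ u ∪ translate q W) 0 ∧
      ∃ s, s + c.2.1 = q + L ∧ OccursAt c.1 c.2.1 0 (q + L) (W ∪ u ∪ translate q W) s := by
    rintro c hc h1 h2 h3 ⟨s, hs, h4⟩
    refine ⟨?_, ?_, q + s, by omega, (h4.translate q).union_right (by omega) hWu⟩
    · exact IsTight.union hc (by omega) (by omega)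
        (IsTight.union hc (by omega) hLq h1 h2 hW hu' (Or.inr ⟨s, hs, h4⟩))
        (h1.translate q) hWu hT (Or.inl (h3.translate q))
    · exact (h3.union_left hLq hu').union_left (by omega) hT
  have key' : ∀ c ∈ insert (W, L, K + L) F,
      IsTight c 0 (q + L) (W ∪ u ∪ translate q W) ∧
      OccursAt c.1 c.2.1 0 (q + L) (W ∪ u ∪ translate q W) 0 ∧
      ∃ s, s + c.2.1 = q + L ∧ OccursAt c.1 c.2.1 0 (q + L) (W ∪ u ∪ translate q W) s := by
    rintro c (rfl | hc)
    · exact key _ hL (isTight_self hL) (isTight_of_short hL (by simp; omega)) (occursAt_self W L)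
        ⟨0, by simp, occursAt_self W L⟩
    · exact key c (h.pos_of_mem c hc) (h.tight c hc) (hut c hc) (h.starts c hc) (h.ends c hc)
  refine ⟨W ∪ u ∪ translate q W, q + L, ⟨by omega, ?_, h.isFillable_insert hK, ?_,
    fun c hc => (key' c hc).1, fun c hc => (key' c hc).2.1, fun c hc => (key' c hc).2.2⟩,
    by omega, ?_⟩
  · rintro x (hx | hx)
    · refine ⟨?_, by have := hWu hx; simp at this ⊢; omega⟩
      rcases hx with hx | hx
      · exact (h.subset hx).1
      · exact hS (hu hx).1
    · obtain ⟨h1, h2⟩ := id hx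
      have := hq (x - q) (h.subset h2).2.2 (h.subset h2).1
      rw [Nat.add_sub_cancel' h1] at this
      exact ⟨hS this, by have := hT hx; simp at this ⊢; omega⟩
  · rintro c (rfl | hc)
    · exact hL
    · exact h.pos_of_mem c hc
  · intro i hi
    constructor
    · rintro ((h1 | h1) | h1)
      · exact h1
      · have := (hu' h1).1; omega
      · have := h1.1; omega
    · exact fun h => Or.inl (Or.inl h)

/-- If the sets of times at which finite pieces of `S ∪ {m}` may be copied into `S` are all
syndetic, then `S ∪ {m}` contains (the set of ones of) a uniformly recurrent sequence `z` with
`m ∈ z`. -/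
theorem exists_recurrent_subset {S : Set ℕ} {m : ℕ}
    (h : ∀ L, ∃ K, ∀ t, ∃ q ∈ copyTimes S (insert m S) L, t ≤ q ∧ q ≤ t + K) :
    ∃ z ⊆ insert m S, m ∈ z ∧
      ∀ L, ∃ K, ∀ t, ∃ s, t ≤ s ∧ s ≤ t + K ∧ ∀ i < L, (s + i ∈ z ↔ i ∈ z) := by
  choose K hK using h
  let St := {x : Set (Set ℕ × ℕ × ℕ) × Set ℕ × ℕ // IsStage S (insert m S) x.1 x.2.1 x.2.2}
  have step : ∀ x : St, ∃ y : St, y.1.1 = insert (x.1.2.1, x.1.2.2, K x.1.2.2 + x.1.2.2) x.1.1 ∧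
      x.1.2.2 < y.1.2.2 ∧ ∀ i < x.1.2.2, (i ∈ y.1.2.1 ↔ i ∈ x.1.2.1) := by
    rintro ⟨⟨F, W, L⟩, hx⟩
    obtain ⟨W', L', h1, h2, h3⟩ := hx.exists_next (Set.subset_insert m S) (hK L)
    exact ⟨⟨⟨_, W', L'⟩, h1⟩, rfl, h2, h3⟩
  choose nxt hnF hnL hnW using step
  -- The initial word has its single one at `m`; with no earlier words, all compatibility conditions
  -- are vacuous.
  let x0 : St := ⟨⟨∅, {m}, m + 1⟩, ⟨by simp, by simp, fun a b _ => ⟨∅, by simp, by simp⟩,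
    by simp, by simp, by simp, by simp⟩⟩
  let x : ℕ → St := fun n => nxt^[n] x0
  have xs : ∀ n, x (n + 1) = nxt (x n) := fun n => Function.iterate_succ_apply' nxt n x0
  let W : ℕ → Set ℕ := fun n => (x n).1.2.1
  let L : ℕ → ℕ := fun n => (x n).1.2.2
  have hLs : StrictMono L := strictMono_nat_of_lt_succ fun n => by
    simp only [L, xs]; exact hnL (x n)
  have hWs : ∀ n k, ∀ i < L n, (i ∈ W (n + k) ↔ i ∈ W n) := by
    intro n k
    induction k with
    | zero => simp
    | succ k ih =>
      intro i hi
      rw [← ih i hi]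
      have := hnW (x (n + k)) i (lt_of_lt_of_le hi (hLs.monotone (Nat.le_add_right n k)))
      rwa [← xs] at this
  have hF : ∀ n k, (W n, L n, K (L n) + L n) ∈ (x (n + 1 + k)).1.1 := by
    intro n k
    induction k with
    | zero => rw [add_zero, xs, hnF]; exact Set.mem_insert _ _
    | succ k ih =>
      rw [← add_assoc, xs, hnF]; exact Set.mem_insert_of_mem _ ih
  let z : Set ℕ := {i | ∃ n, i < L n ∧ i ∈ W n}
  have hz : ∀ n, ∀ i < L n, (i ∈ z ↔ i ∈ W n) := by
    intro n i hi
    constructor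
    · rintro ⟨k, h1, h2⟩
      rcases le_total n k with hnk | hnk
      · obtain ⟨d, rfl⟩ := Nat.exists_eq_add_of_le hnk
        exact (hWs n d i hi).1 h2
      · obtain ⟨d, rfl⟩ := Nat.exists_eq_add_of_le hnk
        exact (hWs k d i h1).2 h2
    · exact fun h => ⟨n, hi, h⟩
  refine ⟨z, ?_, ⟨0, by simp [L, x, x0], by simp [W, x, x0]⟩, ?_⟩
  · rintro i ⟨n, _, h2⟩
    exact ((x n).2.subset h2).1
  · intro l
    refine ⟨K (L l) + 2 * L l, fun t => ?_⟩
    -- Tightness is applied at `t + L l`, because the occurrence found may start almost `L l`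
    -- earlier. It starts by `t + K (L l) + 2 * L l < T`, so a stage of length at least `T` excludes
    -- the end-of-word alternative.
    set T := t + K (L l) + 3 * L l with hT
    have hid := hLs.id_le
    have hstage := (x (l + 1 + T)).2
    have hLT : T ≤ L (l + 1 + T) := (Nat.le_add_left _ _).trans (hid _)
    have hl0 : 0 < L l := (x l).2.pos
    have hll : l ≤ L l := hid l
    obtain ⟨s, hs, h1, h2⟩ := hstage.tight _ (hF l T) (t + L l) (by omega)
      (show _ ≤ L (l + 1 + T) by omega)
    simp only at h1 h2
    rcases hs with hs | hs
    · change s = L (l + 1 + T) at hs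
      omega
    · refine ⟨s, by omega, by omega, fun i hi => ?_⟩
      have h3 := hs.2.2 i (show i < L l by omega)
      have h4 := hs.2.1
      simp only at h3 h4
      rw [hz (l + 1 + T) (s + i) (show _ < L (l + 1 + T) from lt_of_lt_of_le (by omega) h4),
        hz l i (by omega)]
      exact h3


/-! ### Combinatorics of syndetic and thick sets -/

theorem isSyndetic_iff {A : Set ℕ+} :
    IsSyndetic A ↔ ∃ N : ℕ, ∀ m : ℕ, ∃ n : ℕ+, m < n ∧ (n : ℕ) ≤ m + N ∧ n ∈ A := by
  constructor
  · rintro ⟨N, hN⟩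
    refine ⟨N + 1, fun m => ?_⟩
    have h : m.succPNat ∈ unionShifts A N := hN ▸ Set.mem_univ _
    rcases h with h | ⟨k, hk, h⟩
    · exact ⟨_, by simp, by simp, h⟩
    · have : (k : ℕ) ≤ N := hk
      exact ⟨_, by simp; omega, by simp; omega, h⟩
  · rintro ⟨N, hN⟩
    refine ⟨N.succPNat, Set.eq_univ_of_forall fun m => ?_⟩
    obtain ⟨n, h1, h2, h3⟩ := hN (m - 1)
    have hm := m.pos
    rcases eq_or_ne m n with rfl | hne
    · exact Or.inl h3
    · have hlt : m < n := lt_of_le_of_ne (show (m : ℕ) ≤ n by omega) hne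
      refine Or.inr ⟨n - m, ?_, by rwa [add_comm, PNat.sub_add_of_lt hlt]⟩
      rw [← PNat.coe_le_coe, PNat.sub_coe, if_pos hlt]
      simp
      omega

theorem IsThick.exists_interval {A : Set ℕ+} (h : IsThick A) (L M : ℕ) :
    ∃ n : ℕ, M ≤ n ∧ ∀ k : ℕ+, n < k → (k : ℕ) ≤ n + L → k ∈ A := by
  obtain ⟨n, hn⟩ := h (Finset.Icc 1 (M + L).succPNat)
  refine ⟨n + M, by omega, fun k h1 h2 => ?_⟩
  have hlt : n < k := show (n : ℕ) < k by omega
  have h3 := hn (k - n) (by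
    rw [Finset.mem_Icc]
    refine ⟨one_le, ?_⟩
    rw [← PNat.coe_le_coe, PNat.sub_coe, if_pos hlt]
    simp
    omega)
  rwa [PNat.sub_add_of_lt hlt] at h3

theorem isThick_of_interval {A : Set ℕ+}
    (h : ∀ L : ℕ, ∃ n : ℕ, ∀ k : ℕ+, n < k → (k : ℕ) ≤ n + L → k ∈ A) : IsThick A := by
  intro F
  obtain ⟨n, hn⟩ := h (F.sup (fun f : ℕ+ => (f : ℕ)) + 1)
  refine ⟨n.succPNat, fun f hf => hn _ ?_ ?_⟩
  · simp
    have := f.pos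
    omega
  · have : (f : ℕ) ≤ _ := Finset.le_sup (f := fun f : ℕ+ => (f : ℕ)) hf
    simp
    omega

theorem IsSyndetic.inter_isThick {A B : Set ℕ+} (hA : IsSyndetic A) (hB : IsThick B) :
    ∃ n ∈ A, n ∈ B := by
  obtain ⟨N, hN⟩ := isSyndetic_iff.1 hA
  obtain ⟨n, -, hn⟩ := hB.exists_interval N 0
  obtain ⟨k, h1, h2, h3⟩ := hN n
  exact ⟨k, h3, hn k h1 h2⟩

theorem IsSyndetic.mono {A B : Set ℕ+} (hA : IsSyndetic A) (h : A ⊆ B) : IsSyndetic B := by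
  obtain ⟨N, hN⟩ := isSyndetic_iff.1 hA
  refine isSyndetic_iff.2 ⟨N, fun m => ?_⟩
  obtain ⟨k, h1, h2, h3⟩ := hN m
  exact ⟨k, h1, h2, h h3⟩

/-- The complement of a set that is not piecewise syndetic is thickly syndetic. -/
theorem exists_gap_of_not_isPiecewiseSyndetic {A : Set ℕ+} (hA : ¬ IsPiecewiseSyndetic A)
    (l : ℕ) : ∃ K : ℕ, ∀ t : ℕ, ∃ s : ℕ, t ≤ s ∧ s ≤ t + K ∧
      ∀ k : ℕ+, s < k → (k : ℕ) ≤ s + l → k ∉ A := by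
  simp only [IsPiecewiseSyndetic, not_exists] at hA
  have h := hA l.succPNat
  simp only [IsThick, not_forall, not_exists] at h
  obtain ⟨F, hF⟩ := h
  refine ⟨F.sup (fun f : ℕ+ => (f : ℕ)) + 1, fun t => ?_⟩
  obtain ⟨f, hf, hft⟩ := hF t.succPNat
  have : (f : ℕ) ≤ _ := Finset.le_sup (f := fun f : ℕ+ => (f : ℕ)) hf
  refine ⟨f + t, by omega, by omega, fun k h1 h2 hk => hft ?_⟩
  rcases eq_or_ne (f + t.succPNat) k with rfl | hne
  · exact Or.inl hk
  · have hlt : f + t.succPNat < k :=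
      lt_of_le_of_ne (show ((f + t.succPNat : ℕ+) : ℕ) ≤ k by simp; omega) hne
    refine Or.inr ⟨k - (f + t.succPNat), ?_, by rwa [add_comm, PNat.sub_add_of_lt hlt]⟩
    rw [← PNat.coe_le_coe, PNat.sub_coe, if_pos hlt]
    simp
    omega

theorem IsPiecewiseSyndetic.exists_interval {A : Set ℕ+} (hA : IsPiecewiseSyndetic A) :
    ∃ N : ℕ, ∀ L : ℕ, ∃ n : ℕ, 0 < n ∧ ∀ i < L, ∃ k ≤ N, ∃ a ∈ A, n + i + k = (a : ℕ) := by
  obtain ⟨N, hN⟩ := hA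
  refine ⟨N, fun L => ?_⟩
  obtain ⟨n, -, hn⟩ := hN.exists_interval L 0
  refine ⟨n + 1, by omega, fun i hi => ?_⟩
  rcases hn ⟨n + 1 + i, by omega⟩ (by simp; omega) (by simp; omega) with h | ⟨k, hk, h⟩
  · exact ⟨0, by simp, _, h, rfl⟩
  · exact ⟨k, hk, _, h, rfl⟩

/-! ### Minimal systems and uniformly recurrent points -/

section Dynamics

variable {X : Type} [MetricSpace X] [CompactSpace X] {T : X → X}

/-- The points that never enter `U` form a closed invariant proper subset, hence an empty one. By
compactness the entrance times are bounded. -/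
theorem IsMinimalSystem.isSyndetic_returnTimes (hT : IsMinimalSystem T) (x : X) {U : Set X}
    (hU : IsOpen U) (hne : U.Nonempty) : IsSyndetic (returnTimes T x U) := by
  obtain ⟨-, hc, hmin⟩ := hT
  have hcover : (Set.univ : Set X) ⊆ ⋃ n : ℕ, T^[n] ⁻¹' U := by
    by_contra hcon
    have hcl : IsClosed (⋃ n : ℕ, T^[n] ⁻¹' U)ᶜ :=
      (isOpen_iUnion fun n => hU.preimage (hc.iterate n)).isClosed_compl
    have hne' : ((⋃ n : ℕ, T^[n] ⁻¹' U)ᶜ).Nonempty := by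
      rw [Set.nonempty_compl]
      exact fun h => hcon h.ge
    have := hmin _ hne' hcl (by
      intro y hy
      simp only [Set.mem_compl_iff, Set.mem_iUnion, Set.mem_preimage, not_exists] at hy ⊢
      intro n
      rw [← Function.iterate_succ_apply]
      exact hy _)
    obtain ⟨u, hu⟩ := hne
    have h2 : u ∈ (⋃ n : ℕ, T^[n] ⁻¹' U)ᶜ := this ▸ Set.mem_univ u
    exact h2 (Set.mem_iUnion.2 ⟨0, hu⟩)
  obtain ⟨t, ht⟩ := isCompact_univ.elim_finite_subcover _
    (fun n => hU.preimage (hc.iterate n)) hcover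
  refine isSyndetic_iff.2 ⟨t.sup id + 1, fun m => ?_⟩
  have := ht (Set.mem_univ (T^[m + 1] x))
  simp only [Set.mem_iUnion, Set.mem_preimage, exists_prop] at this
  obtain ⟨n, hn, hx⟩ := this
  have hle : n ≤ t.sup id := Finset.le_sup (f := id) hn
  refine ⟨⟨n + (m + 1), by omega⟩, by simp; omega, by simp; omega, ?_⟩
  change T^[n + (m + 1)] x ∈ U
  rwa [Function.iterate_add_apply]

/-- `M` is a minimal subset of the system. -/
def IsMinimalSet (T : X → X) (M : Set X) : Prop :=
  Minimal (fun Y : Set X => Y.Nonempty ∧ IsClosed Y ∧ Set.MapsTo T Y Y) M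

theorem exists_isMinimalSet {Y : Set X} (hne : Y.Nonempty) (hY : IsClosed Y)
    (hm : Set.MapsTo T Y Y) : ∃ M ⊆ Y, IsMinimalSet T M := by
  refine zorn_superset_nonempty {Y : Set X | Y.Nonempty ∧ IsClosed Y ∧ Set.MapsTo T Y Y} ?_ Y
    ⟨hne, hY, hm⟩
  intro c hc hchain hcne
  refine ⟨⋂₀ c, ⟨?_, isClosed_sInter fun s hs => (hc hs).2.1, fun x hx s hs =>
    (hc hs).2.2 (hx s hs)⟩, fun s hs => Set.sInter_subset_of_mem hs⟩
  exact @IsCompact.nonempty_sInter_of_directed_nonempty_isCompact_isClosed _ _ _ hcne.to_subtype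
    (IsChain.directedOn hchain.symm) (fun s hs => (hc hs).1) (fun s hs => (hc hs).2.1.isCompact)
    (fun s hs => (hc hs).2.1)

omit [CompactSpace X] in
theorem IsMinimalSet.eq_of_subset {M Y : Set X} (h : IsMinimalSet T M) (hne : Y.Nonempty)
    (hY : IsClosed Y) (hm : Set.MapsTo T Y Y) (hYM : Y ⊆ M) : Y = M :=
  hYM.antisymm (h.2 ⟨hne, hY, hm⟩ hYM)

theorem IsMinimalSet.exists_isMinimalSystem {M : Set X} (h : IsMinimalSet T M)
    (hT : Continuous T) : ∃ (_ : CompactSpace M) (S : M → M), IsMinimalSystem S ∧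
      ∀ (n : ℕ) (x : M), (S^[n] x : X) = T^[n] x := by
  obtain ⟨hne, hcl, hm⟩ := h.1
  have := isCompact_iff_compactSpace.1 hcl.isCompact
  have hit : ∀ (n : ℕ) (x : M), ((hm.restrict T M M)^[n] x : X) = T^[n] x := by
    intro n
    induction n with
    | zero => intro x; rfl
    | succ n ih => intro x; rw [Function.iterate_succ_apply, Function.iterate_succ_apply, ih]; rfl
  refine ⟨inferInstance, hm.restrict T M M, ⟨hne.to_subtype, hT.restrict hm, ?_⟩, hit⟩
  intro Y hY hYc hYm
  have h1 : ((↑) '' Y : Set X) = M := by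
    refine h.eq_of_subset (hY.image _) (hcl.isClosedEmbedding_subtypeVal.isClosedMap _ hYc) ?_
      (by rintro _ ⟨y, -, rfl⟩; exact y.2)
    rintro _ ⟨y, hy, rfl⟩
    exact ⟨_, hYm hy, rfl⟩
  refine Set.eq_univ_of_forall fun y => ?_
  have h2 : (y : X) ∈ ((↑) '' Y : Set X) := by rw [h1]; exact y.2
  obtain ⟨y', hy', he⟩ := h2
  rwa [← Subtype.ext he]

theorem IsMinimalSet.isSyndetic_returnTimes {M : Set X} (h : IsMinimalSet T M)
    (hT : Continuous T) {x : X} (hx : x ∈ M) {U : Set X} (hU : IsOpen U) (hne : (U ∩ M).Nonempty) :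
    IsSyndetic (returnTimes T x U) := by
  obtain ⟨_, S, hS, hit⟩ := h.exists_isMinimalSystem hT
  obtain ⟨u, hu, huM⟩ := hne
  refine (hS.isSyndetic_returnTimes ⟨x, hx⟩ (hU.preimage continuous_subtype_val)
    ⟨⟨u, huM⟩, hu⟩).mono fun n hn => ?_
  simpa [returnTimes, hit] using hn

theorem IsMinimalSet.isUniformlyRecurrent {M : Set X} (h : IsMinimalSet T M)
    (hT : Continuous T) {x : X} (hx : x ∈ M) : IsUniformlyRecurrent T x :=
  fun _ hU hxU => h.isSyndetic_returnTimes hT hx hU ⟨x, hxU, hx⟩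

theorem IsMinimalSet.isDynSyndetic {M : Set X} (h : IsMinimalSet T M)
    (hT : Continuous T) {x : X} (hx : x ∈ M) {U : Set X} (hU : IsOpen U) (hne : (U ∩ M).Nonempty) :
    IsDynSyndetic (returnTimes T x U) := by
  obtain ⟨_, S, hS, hit⟩ := h.exists_isMinimalSystem hT
  obtain ⟨u, hu, huM⟩ := hne
  refine ⟨M, inferInstance, inferInstance, S, ⟨x, hx⟩, Subtype.val ⁻¹' U, hS,
    hU.preimage continuous_subtype_val, ⟨⟨u, huM⟩, hu⟩, fun n hn => ?_⟩
  simpa [returnTimes, hit] using hn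

theorem IsMinimalSet.isDynCentralSyndetic {M : Set X} (h : IsMinimalSet T M)
    (hT : Continuous T) {x : X} (hx : x ∈ M) {U : Set X} (hU : IsOpen U) (hxU : x ∈ U) :
    IsDynCentralSyndetic (returnTimes T x U) := by
  obtain ⟨_, S, hS, hit⟩ := h.exists_isMinimalSystem hT
  refine ⟨M, inferInstance, inferInstance, S, ⟨x, hx⟩, Subtype.val ⁻¹' U, hS,
    hU.preimage continuous_subtype_val, hxU, fun n hn => ?_⟩
  simpa [returnTimes, hit] using hn

omit [CompactSpace X] in
theorem mapsTo_closure_orbit (hT : Continuous T) (x : X) :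
    Set.MapsTo T (closure (Set.range fun n : ℕ => T^[n] x))
      (closure (Set.range fun n : ℕ => T^[n] x)) := by
  refine Set.MapsTo.closure ?_ hT
  rintro _ ⟨n, rfl⟩
  exact ⟨n + 1, Function.iterate_succ_apply' T n x⟩

omit [CompactSpace X] in
/-- The orbit closure of a uniformly recurrent point is minimal. -/
theorem IsUniformlyRecurrent.isMinimalSet (hT : Continuous T) {x : X}
    (hx : IsUniformlyRecurrent T x) :
    IsMinimalSet T (closure (Set.range fun n : ℕ => T^[n] x)) := by
  refine ⟨⟨⟨x, subset_closure ⟨0, rfl⟩⟩, isClosed_closure, mapsTo_closure_orbit hT x⟩, ?_⟩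
  rintro Y ⟨hY, hYc, hYm⟩ hYsub
  suffices hxY : x ∈ Y by
    refine closure_minimal ?_ hYc
    rintro _ ⟨n, rfl⟩
    exact hYm.iterate n hxY
  by_contra hxY
  obtain ⟨V, hV, hVo, hxV⟩ : ∃ V : Set X, closure V ⊆ Yᶜ ∧ IsOpen V ∧ x ∈ V := by
    obtain ⟨V, hV, hVc, hVY⟩ := exists_mem_nhds_isClosed_subset (hYc.isOpen_compl.mem_nhds hxY)
    exact ⟨interior V, (closure_minimal interior_subset hVc).trans hVY, isOpen_interior,
      mem_interior_iff_mem_nhds.2 hV⟩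
  obtain ⟨N, hN⟩ := isSyndetic_iff.1 (hx V hVo hxV)
  -- Bounded return gaps put the whole orbit closure within boundedly many steps of `closure V`,
  -- while the invariant set `Y` never reaches it.
  have hcov : closure (Set.range fun n : ℕ => T^[n] x) ⊆
      ⋃ k ∈ Finset.range (N + 1), T^[k] ⁻¹' closure V := by
    refine closure_minimal ?_ (isClosed_biUnion_finset fun k _ =>
      isClosed_closure.preimage (hT.iterate k))
    rintro _ ⟨n, rfl⟩
    obtain ⟨k, h1, h2, h3⟩ := hN n
    simp only [Set.mem_iUnion, Set.mem_preimage, Finset.mem_range, exists_prop]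
    refine ⟨k - n, by omega, subset_closure ?_⟩
    rw [← Function.iterate_add_apply, Nat.sub_add_cancel h1.le]
    exact h3
  obtain ⟨y, hy⟩ := hY
  have := hcov (hYsub hy)
  simp only [Set.mem_iUnion, Set.mem_preimage, Finset.mem_range, exists_prop] at this
  obtain ⟨k, -, hk⟩ := this
  exact hV hk (hYm.iterate k hy)

omit [CompactSpace X] in
theorem mem_closure_orbit (x : X) (n : ℕ) :
    T^[n] x ∈ closure (Set.range fun n : ℕ => T^[n] x) := subset_closure ⟨n, rfl⟩

/-- A uniformly recurrent point is uniformly recurrent for every power of the map. -/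
theorem IsUniformlyRecurrent.iterate (hT : Continuous T) {x : X}
    (hx : IsUniformlyRecurrent T x) {N : ℕ} (hN : 0 < N) : IsUniformlyRecurrent T^[N] x := by
  have hM := hx.isMinimalSet hT
  set M := closure (Set.range fun n : ℕ => T^[n] x)
  obtain ⟨Y, hYM, hY⟩ := exists_isMinimalSet (T := T^[N]) hM.1.1 hM.1.2.1 (hM.1.2.2.iterate N)
  -- The first `N` images of a `T^[N]`-minimal set form a closed `T`-invariant set, so they exhaust
  -- `M` and `x` is an image of a point of `Y`.
  have hunion : (⋃ i ∈ Finset.range N, T^[i] '' Y) = M := by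
    refine hM.eq_of_subset ?_ (isClosed_biUnion_finset fun i _ =>
      (hY.1.2.1.isCompact.image (hT.iterate i)).isClosed) ?_ ?_
    · obtain ⟨y, hy⟩ := hY.1.1
      exact ⟨y, Set.mem_biUnion (Finset.mem_coe.2 (Finset.mem_range.2 hN)) ⟨y, hy, rfl⟩⟩
    · intro z hz
      simp only [Set.mem_iUnion, Finset.mem_range, exists_prop, Set.mem_image] at hz ⊢
      obtain ⟨i, hi, y, hy, rfl⟩ := hz
      rw [← Function.iterate_succ_apply' T]
      rcases Nat.lt_or_ge (i + 1) N with h | h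
      · exact ⟨i + 1, h, y, hy, rfl⟩
      · exact ⟨0, hN, _, hY.1.2.2 hy, by rw [show i.succ = N by omega]; rfl⟩
    · intro z hz
      simp only [Set.mem_iUnion, Finset.mem_range, exists_prop, Set.mem_image] at hz
      obtain ⟨i, hi, y, hy, rfl⟩ := hz
      exact hM.1.2.2.iterate i (hYM hy)
  have hxM : x ∈ ⋃ i ∈ Finset.range N, T^[i] '' Y := hunion ▸ mem_closure_orbit x 0
  simp only [Set.mem_iUnion, Finset.mem_range, exists_prop, Set.mem_image] at hxM
  obtain ⟨i, -, y, hy, rfl⟩ := hxM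
  intro V hV hyV
  refine ((hY.isUniformlyRecurrent (hT.iterate N) hy) (T^[i] ⁻¹' V)
    (hV.preimage (hT.iterate i)) hyV).mono fun n hn => ?_
  simp only [returnTimes, Set.mem_ofPred_eq, Set.mem_preimage] at hn ⊢
  rwa [← Function.iterate_mul, ← Function.iterate_add_apply, add_comm,
    Function.iterate_add_apply, Function.iterate_mul] at hn

theorem IsUniformlyRecurrent.isSyndetic_dvd (hT : Continuous T) {x : X}
    (hx : IsUniformlyRecurrent T x) {N : ℕ} (hN : 0 < N) {V : Set X} (hV : IsOpen V)
    (hxV : x ∈ V) : IsSyndetic {n : ℕ+ | N ∣ n ∧ T^[(n : ℕ)] x ∈ V} := by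
  obtain ⟨K, hK⟩ := isSyndetic_iff.1 (hx.iterate hT hN V hV hxV)
  refine isSyndetic_iff.2 ⟨N * K, fun m => ?_⟩
  obtain ⟨n, h1, h2, h3⟩ := hK (m / N)
  refine ⟨⟨N * n, Nat.mul_pos hN n.pos⟩, ?_, ?_, ?_, ?_⟩
  · exact by simpa [mul_comm] using (Nat.div_lt_iff_lt_mul hN).1 h1
  · calc N * (n : ℕ) ≤ N * (m / N + K) := Nat.mul_le_mul_left _ h2
      _ = N * (m / N) + N * K := by ring
      _ ≤ _ := Nat.add_le_add_right (Nat.mul_div_le m N) _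
  · simp
  · simpa [returnTimes, Function.iterate_mul] using h3

theorem IsMinimalSystem.isUniformlyRecurrent (h : IsMinimalSystem T) (x : X) :
    IsUniformlyRecurrent T x := fun _ hU hx => h.isSyndetic_returnTimes x hU ⟨x, hx⟩

end Dynamics

theorem IsThick.isDynThick {A : Set ℕ+} (h : IsThick A) : IsDynThick A := by
  intro X _ _ T hT x U hU hne
  obtain ⟨n, h1, h2⟩ := (hT.isSyndetic_returnTimes x hU hne).inter_isThick h
  exact ⟨n, h2, h1⟩

theorem IsDynThick.isSetOfPointwiseRecurrence {A : Set ℕ+} (h : IsDynThick A) :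
    IsSetOfPointwiseRecurrence A :=
  fun X _ _ T hT x U hU hx => h X T hT x U hU ⟨x, hx⟩


/-! ### The shift on 0-1 sequences -/

/-- The space of 0-1 sequences. -/
def SeqSpace : Type := ℕ → Bool

namespace SeqSpace

noncomputable instance : MetricSpace SeqSpace :=
  TopologicalSpace.metrizableSpaceMetric (ℕ → Bool)

instance : CompactSpace SeqSpace := inferInstanceAs (CompactSpace (ℕ → Bool))

/-- The shift map. -/
def shift (y : SeqSpace) : SeqSpace := fun n => y (n + 1)

theorem continuous_eval (i : ℕ) : Continuous fun y : SeqSpace => y i :=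
  continuous_apply (A := fun _ : ℕ => Bool) i

theorem continuous_shift : Continuous shift :=
  continuous_pi (A := fun _ : ℕ => Bool) fun i => continuous_eval (i + 1)

theorem shift_iterate (k : ℕ) (y : SeqSpace) (n : ℕ) : shift^[k] y n = y (n + k) := by
  induction k generalizing y with
  | zero => rfl
  | succ k ih => rw [Function.iterate_succ_apply, ih]; rfl

/-- The indicator sequence of a set. -/
noncomputable def indicator (z : Set ℕ) : SeqSpace := fun n => by
  classical exact decide (n ∈ z)

theorem indicator_apply {z : Set ℕ} {n : ℕ} : indicator z n = true ↔ n ∈ z := by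
  simp [indicator]

theorem indicator_eq_iff {z z' : Set ℕ} {n n' : ℕ} :
    indicator z n = indicator z' n' ↔ (n ∈ z ↔ n' ∈ z') := by
  rw [Bool.eq_iff_iff, indicator_apply, indicator_apply]

/-- The sequences that agree with `y` on `[0, L)`. -/
def cylinder (y : SeqSpace) (L : ℕ) : Set SeqSpace := {w | ∀ i < L, w i = y i}

theorem isOpen_eval_eq (i : ℕ) (b : Bool) : IsOpen {w : SeqSpace | w i = b} :=
  (isOpen_discrete {b}).preimage (continuous_eval i)

theorem isOpen_cylinder (y : SeqSpace) (L : ℕ) : IsOpen (cylinder y L) := by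
  have : cylinder y L = ⋂ i ∈ Finset.range L, {w : SeqSpace | w i = y i} := by
    ext w; simp [cylinder]
  rw [this]
  exact isOpen_biInter_finset fun i _ => isOpen_eval_eq i (y i)

theorem exists_cylinder_subset {y : SeqSpace} {V : Set SeqSpace} (hV : IsOpen V) (hy : y ∈ V) :
    ∃ L, cylinder y L ⊆ V := by
  obtain ⟨I, u, hu, hsub⟩ := isOpen_pi_iff (A := fun _ : ℕ => Bool).1 hV y hy
  refine ⟨I.sup id + 1, fun w hw => hsub fun i hi => ?_⟩
  have hle : i ≤ I.sup id := Finset.le_sup (f := id) hi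
  rw [hw i (by omega)]
  exact (hu i hi).2

theorem isUniformlyRecurrent_indicator {z : Set ℕ}
    (hz : ∀ L, ∃ K, ∀ t, ∃ s, t ≤ s ∧ s ≤ t + K ∧ ∀ i < L, (s + i ∈ z ↔ i ∈ z)) :
    IsUniformlyRecurrent shift (indicator z) := by
  intro V hV hzV
  obtain ⟨L, hL⟩ := exists_cylinder_subset hV hzV
  obtain ⟨K, hK⟩ := hz L
  refine isSyndetic_iff.2 ⟨K + 1, fun m => ?_⟩
  obtain ⟨s, h1, h2, h3⟩ := hK (m + 1)
  refine ⟨⟨s, by omega⟩, by simp; omega, by simp; omega, hL fun i hi => ?_⟩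
  rw [PNat.mk_coe, shift_iterate, indicator_eq_iff, add_comm]
  exact h3 i hi

theorem returnTimes_indicator (z : Set ℕ) :
    returnTimes shift (indicator z) {w | w 0 = true} = {n : ℕ+ | (n : ℕ) ∈ z} := by
  ext n
  change shift^[(n : ℕ)] (indicator z) 0 = true ↔ (n : ℕ) ∈ z
  rw [shift_iterate, indicator_apply, zero_add]

end SeqSpace

-- The one at `0` puts the sequence itself in the open set `{w | w 0 = true}`. As return times are
-- positive, the added `0` is never among them.
open SeqSpace in
theorem isDynCentralSyndetic_of_copyTimes {S : Set ℕ}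
    (h : ∀ L, ∃ K, ∀ t, ∃ q ∈ copyTimes S (insert 0 S) L, t ≤ q ∧ q ≤ t + K) :
    IsDynCentralSyndetic {n : ℕ+ | (n : ℕ) ∈ S} := by
  obtain ⟨z, hzS, hz0, hz⟩ := exists_recurrent_subset h
  have hur := isUniformlyRecurrent_indicator hz
  obtain ⟨X, i1, i2, T, x, U, hT, hU, hx, hsub⟩ :=
    (hur.isMinimalSet continuous_shift).isDynCentralSyndetic continuous_shift
      (mem_closure_orbit _ 0) (isOpen_eval_eq 0 true) (indicator_apply.2 hz0)
  refine ⟨X, i1, i2, T, x, U, hT, hU, hx, fun n hn => ?_⟩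
  have h1 : n ∈ {n : ℕ+ | (n : ℕ) ∈ z} := returnTimes_indicator z ▸ hsub hn
  exact (hzS h1).resolve_left n.ne_zero

open SeqSpace in
theorem isDynSyndetic_of_copyTimes {S : Set ℕ} {m : ℕ} (hm : m ∈ S)
    (h : ∀ L, ∃ K, ∀ t, ∃ q ∈ copyTimes S (insert m S) L, t ≤ q ∧ q ≤ t + K) :
    IsDynSyndetic {n : ℕ+ | (n : ℕ) ∈ S} := by
  obtain ⟨z, hzS, hzm, hz⟩ := exists_recurrent_subset h
  rw [Set.insert_eq_of_mem hm] at hzS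
  have hur := isUniformlyRecurrent_indicator hz
  obtain ⟨X, i1, i2, T, x, U, hT, hU, hx, hsub⟩ :=
    (hur.isMinimalSet continuous_shift).isDynSyndetic continuous_shift
      (mem_closure_orbit _ 0) (isOpen_eval_eq 0 true)
      ⟨_, by
        change shift^[m] (indicator z) 0 = true
        rwa [shift_iterate, indicator_apply, zero_add], mem_closure_orbit _ m⟩
  refine ⟨X, i1, i2, T, x, U, hT, hU, hx, fun n hn => ?_⟩
  have h1 : n ∈ {n : ℕ+ | (n : ℕ) ∈ z} := returnTimes_indicator z ▸ hsub hn
  exact hzS h1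

/-! ### Copy times inside sets of return times -/

section Dynamics

variable {X : Type} [MetricSpace X] {T : X → X}

theorem exists_copyTimes (hT : Continuous T) {x : X} {U : Set X} (hU : IsOpen U) {D : Set ℕ}
    {m : ℕ} (hm : T^[m] x ∈ U)
    (hD : ∀ V, IsOpen V → x ∈ V → ∀ L, ∃ K, ∀ t, ∃ q, t < q ∧ q ≤ t + K ∧ T^[q] x ∈ V ∧
      ∀ i < L, i ∈ insert m D → q + i ∈ D) (L : ℕ) :
    ∃ K, ∀ t, ∃ q ∈ copyTimes {n | 0 < n ∧ T^[n] x ∈ U ∧ n ∈ D}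
      (insert m {n | 0 < n ∧ T^[n] x ∈ U ∧ n ∈ D}) L, t ≤ q ∧ q ≤ t + K := by
  classical
  -- A return to `V` repeats every visit to `U` made before time `L`.
  let V : Set X := ⋂ i ∈ (Finset.range L).filter (fun i => T^[i] x ∈ U), T^[i] ⁻¹' U
  have hV : IsOpen V := isOpen_biInter_finset fun i _ => hU.preimage (hT.iterate i)
  have hxV : x ∈ V := by simp [V]
  obtain ⟨K, hK⟩ := hD V hV hxV L
  refine ⟨K, fun t => ?_⟩
  obtain ⟨q, h1, h2, h3, h4⟩ := hK t
  refine ⟨q, fun i hi hiS => ?_, h1.le, h2⟩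
  have hi1 : T^[i] x ∈ U := by
    rcases hiS with rfl | hiS
    · exact hm
    · exact hiS.2.1
  refine ⟨by omega, ?_, h4 i hi (hiS.imp_right fun h => h.2.2)⟩
  simp only [V, Set.mem_iInter, Finset.mem_filter, Finset.mem_range, Set.mem_preimage] at h3
  rw [add_comm, Function.iterate_add_apply]
  exact h3 i ⟨hi, hi1⟩

theorem IsUniformlyRecurrent.exists_time_in_gaps {x : X}
    (hx : IsUniformlyRecurrent T x) {D : Set ℕ}
    (hD : ∀ l : ℕ, ∃ K : ℕ, ∀ t : ℕ, ∃ s : ℕ, t ≤ s ∧ s ≤ t + K ∧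
      ∀ k, s < k → k ≤ s + l → k ∈ D) {V : Set X} (hV : IsOpen V) (hxV : x ∈ V) (L : ℕ) :
    ∃ K, ∀ t, ∃ q, t < q ∧ q ≤ t + K ∧ T^[q] x ∈ V ∧ ∀ i < L, q + i ∈ D := by
  obtain ⟨N, hN⟩ := isSyndetic_iff.1 (hx V hV hxV)
  obtain ⟨K, hK⟩ := hD (N + L)
  refine ⟨K + N, fun t => ?_⟩
  obtain ⟨s, h1, h2, h3⟩ := hK t
  obtain ⟨q, h4, h5, h6⟩ := hN s
  exact ⟨q, by omega, by omega, h6, fun i hi => h3 _ (by omega) (by omega)⟩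

end Dynamics

/-- The complement of `A`, as a set of natural numbers, contains long intervals syndetically often
if `A` is not piecewise syndetic. -/
theorem exists_gap_nat {A : Set ℕ+} (hA : ¬ IsPiecewiseSyndetic A) (l : ℕ) :
    ∃ K : ℕ, ∀ t : ℕ, ∃ s : ℕ, t ≤ s ∧ s ≤ t + K ∧
      ∀ k, s < k → k ≤ s + l → k ∈ {n : ℕ | ∀ a ∈ A, (a : ℕ) ≠ n} := by
  obtain ⟨K, hK⟩ := exists_gap_of_not_isPiecewiseSyndetic hA l
  refine ⟨K, fun t => ?_⟩
  obtain ⟨s, h1, h2, h3⟩ := hK t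
  refine ⟨s, h1, h2, fun k h4 h5 a ha hk => ?_⟩
  subst hk
  exact h3 a h4 h5 ha

/-! ### Dynamically piecewise syndetic sets are piecewise syndetic -/

/-- Otherwise the part of `R(x, U)` outside `B ∩ C` would still be dynamically central syndetic, and
`C` would have to meet it. -/
theorem IsDynCentralPiecewiseSyndetic.isPiecewiseSyndetic {A : Set ℕ+}
    (hA : IsDynCentralPiecewiseSyndetic A) : IsPiecewiseSyndetic A := by
  obtain ⟨B, C, ⟨X, _, _, T, x, U, hT, hU, hx, hB⟩, hC, rfl⟩ := hA
  by_contra hps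
  have hur := hT.isUniformlyRecurrent x
  obtain ⟨Y, _, _, R, y, W, hR, hW, hy, hsub⟩ := isDynCentralSyndetic_of_copyTimes
    (exists_copyTimes hT.2.1 hU (m := 0) hx fun V hV hxV L => by
      obtain ⟨K, hK⟩ := hur.exists_time_in_gaps (exists_gap_nat hps) hV hxV L
      exact ⟨K, fun t => (hK t).imp fun q hq =>
        ⟨hq.1, hq.2.1, hq.2.2.1, fun i hi _ => hq.2.2.2 i hi⟩⟩)
  obtain ⟨n, hn, hny⟩ := hC Y R hR y W hW hy
  obtain ⟨-, h1, h2⟩ := hsub hny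
  exact h2 n ⟨hB h1, hn⟩ rfl

theorem IsDynSyndetic.inter_isDynThick {B C : Set ℕ+} (hB : IsDynSyndetic B)
    (hC : IsDynThick C) : IsPiecewiseSyndetic (B ∩ C) := by
  obtain ⟨X, _, _, T, x, U, hT, hU, ⟨u, hu⟩, hB⟩ := hB
  by_contra hps
  have hur := hT.isUniformlyRecurrent x
  have hgap := exists_gap_nat hps
  obtain ⟨m, hm0, hmU, hmD⟩ : ∃ m, 0 < m ∧ T^[m] x ∈ U ∧
      m ∈ {n : ℕ | ∀ a ∈ B ∩ C, (a : ℕ) ≠ n} := by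
    obtain ⟨N, hN⟩ := isSyndetic_iff.1 (hT.isSyndetic_returnTimes x hU ⟨u, hu⟩)
    obtain ⟨K, hK⟩ := hgap N
    obtain ⟨s, -, -, hs⟩ := hK 0
    obtain ⟨n, h1, h2, h3⟩ := hN s
    exact ⟨n, n.pos, h3, hs n h1 h2⟩
  obtain ⟨Y, _, _, R, y, W, hR, hW, hy, hsub⟩ := isDynSyndetic_of_copyTimes
    (S := {n | 0 < n ∧ T^[n] x ∈ U ∧ n ∈ {n : ℕ | ∀ a ∈ B ∩ C, (a : ℕ) ≠ n}}) (m := m)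
    ⟨hm0, hmU, hmD⟩ (exists_copyTimes hT.2.1 hU hmU fun V hV hxV L => by
      obtain ⟨K, hK⟩ := hur.exists_time_in_gaps hgap hV hxV L
      exact ⟨K, fun t => (hK t).imp fun q hq =>
        ⟨hq.1, hq.2.1, hq.2.2.1, fun i hi _ => hq.2.2.2 i hi⟩⟩)
  obtain ⟨n, hn, hny⟩ := hC Y R hR y W hW hy
  obtain ⟨-, h1, h2⟩ := hsub hny
  exact h2 n ⟨hB h1, hn⟩ rfl

/-! ### Piecewise syndetic sets are dynamically piecewise syndetic -/

section Ultrafilters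

attribute [local instance] Ultrafilter.add Ultrafilter.addSemigroup

/-- Every minimal subset of the orbit closure of `x` contains a point that shadows the orbit of `x`
along arbitrarily good return times. -/
theorem exists_proximal_mem {X : Type} [MetricSpace X] [CompactSpace X] {T : X → X}
    (hT : Continuous T) {x : X} {M : Set X} (hM : IsClosed M) (hMT : Set.MapsTo T M M)
    (hne : (M ∩ closure (Set.range fun n : ℕ+ => T^[(n : ℕ)] x)).Nonempty) :
    ∃ y ∈ M, ∀ V, IsOpen V → y ∈ V → ∃ n : ℕ+, T^[(n : ℕ)] x ∈ V ∧ T^[(n : ℕ)] y ∈ V := by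
  let f : X → ℕ+ → X := fun w n => T^[(n : ℕ)] w
  have hlim : ∀ (p : Ultrafilter ℕ+) (w : X),
      Filter.Tendsto (f w) p (nhds (Ultrafilter.extend (f w) p)) := fun p w =>
    ultrafilter_extend_eq_iff.1 rfl
  -- A limit along `p + q` is an iterated limit, by continuity of each iterate of `T`.
  have hadd : ∀ p q : Ultrafilter ℕ+, Ultrafilter.extend (f x) (p + q) =
      Ultrafilter.extend (f (Ultrafilter.extend (f x) q)) p := by
    intro p q
    refine ultrafilter_extend_eq_iff.2 fun V hV => ?_
    obtain ⟨W, hWV, hW, hcW⟩ := mem_nhds_iff.1 hV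
    refine Filter.mem_of_superset (x := W) ?_ hWV
    change ∀ᶠ k in ((p + q : Ultrafilter ℕ+) : Filter ℕ+), f x k ∈ W
    rw [Ultrafilter.eventually_add]
    filter_upwards [hlim p _ (hW.mem_nhds hcW)] with m hm
    filter_upwards [hlim q x ((hW.preimage (hT.iterate m)).mem_nhds hm)] with m' hm'
    simpa [f, Function.iterate_add_apply] using hm'
  -- The ultrafilters that send `x` into `M` form a nonempty closed subsemigroup, so the Ellis lemma
  -- gives an idempotent.
  obtain ⟨p, hpM, hpp⟩ := exists_idempotent_in_compact_add_subsemigroup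
    (M := Ultrafilter ℕ+) Ultrafilter.continuous_add_left
    {p | Ultrafilter.extend (f x) p ∈ M}
    (by
      obtain ⟨w, hwM, hw⟩ := hne
      have : (Filter.comap (f x) (nhds w)).NeBot := by
        refine Filter.comap_neBot fun t ht => ?_
        obtain ⟨_, h1, n, rfl⟩ := mem_closure_iff_nhds.1 hw t ht
        exact ⟨n, h1⟩
      refine ⟨Ultrafilter.of (Filter.comap (f x) (nhds w)), ?_⟩
      have : Ultrafilter.extend (f x) (Ultrafilter.of (Filter.comap (f x) (nhds w))) = w :=
        ultrafilter_extend_eq_iff.2 (Filter.map_le_iff_le_comap.2 (Ultrafilter.of_le _))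
      rwa [Set.mem_ofPred_eq, this])
    ((hM.preimage (continuous_ultrafilter_extend (f x))).isCompact)
    (by
      intro p hp q hq
      rw [Set.mem_ofPred_eq, hadd]
      exact hM.mem_of_tendsto (hlim p _) (Filter.Eventually.of_forall fun m => hMT.iterate m hq))
  refine ⟨Ultrafilter.extend (f x) p, hpM, fun V hV hy => ?_⟩
  have h1 : ∀ᶠ n in (p : Filter ℕ+), f x n ∈ V := hlim p x (hV.mem_nhds hy)
  -- Idempotence makes the limit point its own limit along `p`.
  have h2 : ∀ᶠ n in (p : Filter ℕ+), f (Ultrafilter.extend (f x) p) n ∈ V := hlim p (Ultrafilter.extend (f x) p)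
    (hV.mem_nhds (by rwa [← hadd, hpp]))
  exact (h1.and h2).exists

end Ultrafilters

open SeqSpace in
theorem IsPiecewiseSyndetic.isDynPiecewiseSyndetic {A : Set ℕ+} (hA : IsPiecewiseSyndetic A) :
    IsDynPiecewiseSyndetic A := by
  obtain ⟨N, hN⟩ := hA.exists_interval
  set y0 := indicator ((↑) '' A) with hy0
  let O := closure (Set.range fun n : ℕ+ => shift^[(n : ℕ)] y0)
  have hOm : Set.MapsTo shift O O := by
    refine Set.MapsTo.closure ?_ continuous_shift
    rintro _ ⟨n, rfl⟩
    exact ⟨n + 1, by simp [Function.iterate_succ_apply']⟩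
  -- Sequences with a one in the window `[i, i + N]`; lying in every `G i` means that the gaps
  -- between ones are bounded.
  let G : ℕ → Set SeqSpace := fun i => ⋃ k ∈ Finset.range (N + 1), {w | w (i + k) = true}
  have hG : ∀ i, IsClosed (G i) := fun i => isClosed_biUnion_finset fun k _ =>
    (isClosed_discrete {true}).preimage (continuous_eval (i + k))
  let Y : Set SeqSpace := O ∩ ⋂ i, G i
  have hYc : IsClosed Y := isClosed_closure.inter (isClosed_iInter hG)
  have hYm : Set.MapsTo shift Y Y := by
    rintro w ⟨hw1, hw2⟩
    refine ⟨hOm hw1, Set.mem_iInter.2 fun i => ?_⟩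
    have := Set.mem_iInter.1 hw2 (i + 1)
    simp only [G, Set.mem_iUnion, exists_prop] at this ⊢
    obtain ⟨k, hk, h⟩ := this
    exact ⟨k, hk, by rwa [add_right_comm] at h⟩
  have hYne : Y.Nonempty := by
    have hne : (⋂ L : ℕ, O ∩ ⋂ i ∈ Finset.range L, G i).Nonempty := by
      refine IsCompact.nonempty_iInter_of_sequence_nonempty_isCompact_isClosed _ ?_ ?_ ?_ ?_
      · intro L
        refine Set.inter_subset_inter_right _ (Set.biInter_subset_biInter_left ?_)
        exact Finset.range_subset_range.2 (Nat.le_succ L)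
      · intro L
        obtain ⟨n, hn0, hn⟩ := hN L
        refine ⟨shift^[n] y0, subset_closure ⟨⟨n, hn0⟩, rfl⟩, ?_⟩
        simp only [Set.mem_iInter, Finset.mem_range]
        intro i hi
        obtain ⟨k, hk, a, ha, hak⟩ := hn i hi
        simp only [G, Set.mem_iUnion, exists_prop, Finset.mem_range]
        refine ⟨k, by omega, ?_⟩
        change shift^[n] y0 (i + k) = true
        rw [shift_iterate, hy0, indicator_apply]
        exact ⟨a, ha, by omega⟩
      · exact (isClosed_closure.inter (isClosed_biInter fun i _ => hG i)).isCompact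
      · exact fun L => isClosed_closure.inter (isClosed_biInter fun i _ => hG i)
    obtain ⟨w, hw⟩ := hne
    rw [Set.mem_iInter] at hw
    refine ⟨w, (hw 0).1, Set.mem_iInter.2 fun i => ?_⟩
    exact Set.mem_iInter₂.1 (hw (i + 1)).2 i (by simp)
  obtain ⟨M, hMY, hM⟩ := exists_isMinimalSet hYne hYc hYm
  obtain ⟨y, hyM, hy⟩ := exists_proximal_mem continuous_shift (x := y0) hM.1.2.1 hM.1.2.2 (by
    obtain ⟨w, hw⟩ := hM.1.1
    exact ⟨w, hw, (hMY hw).1⟩)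
  have hyG := Set.mem_iInter.1 (hMY hyM).2 0
  simp only [G, Set.mem_iUnion, exists_prop] at hyG
  obtain ⟨k, -, hk⟩ := hyG
  have hk : y (0 + k) = true := hk
  have hB : IsDynSyndetic (returnTimes shift y {w | w 0 = true}) :=
    hM.isDynSyndetic continuous_shift hyM (isOpen_eval_eq 0 true)
      ⟨shift^[k] y, by
        change shift^[k] y 0 = true
        rwa [shift_iterate], hM.1.2.2.iterate k hyM⟩
  have hC : IsThick {n : ℕ+ | y n = y0 n} := by
    refine isThick_of_interval fun L => ?_
    obtain ⟨n, h1, h2⟩ := hy (cylinder y (L + 1)) (isOpen_cylinder y (L + 1)) fun i _ => rfl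
    refine ⟨n, fun j h3 h4 => ?_⟩
    have h5 := h1 (j - n) (by omega)
    have h6 := h2 (j - n) (by omega)
    rw [shift_iterate, Nat.sub_add_cancel h3.le] at h5 h6
    exact h6.trans h5.symm
  obtain ⟨X, i1, i2, T, x, U, hT, hU, hx, hsub⟩ := hB
  -- Adding `A` to both factors turns the inclusion of the intersection in `A` into an equality.
  refine ⟨returnTimes shift y {w | w 0 = true} ∪ A, {n : ℕ+ | y n = y0 n} ∪ A,
    ⟨X, i1, i2, T, x, U, hT, hU, hx, fun n hn => Or.inl (hsub hn)⟩, ?_, ?_⟩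
  · intro X _ _ T hT x U hU hne
    obtain ⟨n, hn, h⟩ := hC.isDynThick X T hT x U hU hne
    exact ⟨n, Or.inl hn, h⟩
  · rw [← Set.inter_union_distrib_right, eq_comm, Set.union_eq_right]
    rintro n ⟨h1, h2⟩
    have h1 : shift^[(n : ℕ)] y 0 = true := h1
    have h2 : y n = y0 n := h2
    rw [shift_iterate, zero_add, h2, hy0, indicator_apply] at h1
    obtain ⟨a, ha, han⟩ := h1
    rwa [← PNat.coe_injective han]

theorem isDynPiecewiseSyndetic_iff {A : Set ℕ+} :
    IsDynPiecewiseSyndetic A ↔ IsPiecewiseSyndetic A := by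
  refine ⟨?_, fun h => h.isDynPiecewiseSyndetic⟩
  rintro ⟨B, C, hB, hC, rfl⟩
  exact hB.inter_isDynThick hC


/-! ### Central sets -/

/-- By uniform continuity of the first `L` iterates, orbits close enough at one time stay `ε`-close
for the next `L` steps. -/
theorem IsProximal.isThick {X : Type} [MetricSpace X] [CompactSpace X] {T : X → X}
    (hT : Continuous T) {x y : X} (h : IsProximal T x y) {ε : ℝ} (hε : 0 < ε) :
    IsThick {n : ℕ+ | dist (T^[(n : ℕ)] x) (T^[(n : ℕ)] y) < ε} := by
  refine isThick_of_interval fun L => ?_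
  have hmem : (⋂ i ∈ Finset.range (L + 1),
      {p : X × X | dist (T^[i] p.1) (T^[i] p.2) < ε}) ∈ uniformity X := by
    refine (Filter.biInter_finset_mem _).2 fun i _ => ?_
    exact CompactSpace.uniformContinuous_of_continuous (hT.iterate i) (Metric.dist_mem_uniformity hε)
  obtain ⟨δ, hδ, hsub⟩ := Metric.mem_uniformity_dist.1 hmem
  obtain ⟨n, hn⟩ := exists_lt_of_ciInf_lt (lt_of_eq_of_lt h hδ)
  refine ⟨n, fun k h1 h2 => ?_⟩
  have h3 := Set.mem_iInter₂.1 (hsub hn) (k - n) (Finset.mem_range.2 (by omega))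
  change dist (T^[(k : ℕ) - n] _) (T^[(k : ℕ) - n] _) < ε at h3
  rwa [← Function.iterate_add_apply, ← Function.iterate_add_apply,
    Nat.sub_add_cancel h1.le] at h3

theorem IsCentral.exists_inter {A : Set ℕ+} (hA : IsCentral A) :
    ∃ (X : Type) (_ : MetricSpace X) (_ : CompactSpace X) (T : X → X) (x : X) (V : Set X)
      (C : Set ℕ+), Continuous T ∧ IsUniformlyRecurrent T x ∧ IsOpen V ∧ x ∈ V ∧ IsThick C ∧
      returnTimes T x V ∩ C ⊆ A := by
  obtain ⟨X, _, _, T, x, y, U, hT, hx, hxy, hU, hxU, rfl⟩ := hA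
  obtain ⟨ε, hε, hball⟩ := Metric.isOpen_iff.1 hU x hxU
  refine ⟨X, inferInstance, inferInstance, T, x, Metric.ball x (ε / 2), _, hT, hx,
    Metric.isOpen_ball, Metric.mem_ball_self (half_pos hε), hxy.isThick hT (half_pos hε), ?_⟩
  rintro n ⟨h1, h2⟩
  have h1 : dist (T^[(n : ℕ)] x) x < ε / 2 := h1
  have h2 : dist (T^[(n : ℕ)] y) (T^[(n : ℕ)] x) < ε / 2 := h2
  refine hball (Metric.mem_ball.2 ?_)
  linarith [dist_triangle (T^[(n : ℕ)] y) (T^[(n : ℕ)] x) x]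

theorem IsCentral.isDynCentralPiecewiseSyndetic {A : Set ℕ+} (hA : IsCentral A) :
    IsDynCentralPiecewiseSyndetic A := by
  obtain ⟨X, _, _, T, x, V, C, hT, hx, hV, hxV, hC, hsub⟩ := hA.exists_inter
  obtain ⟨Y, i1, i2, R, y, W, hR, hW, hy, hYsub⟩ :=
    (hx.isMinimalSet hT).isDynCentralSyndetic hT (mem_closure_orbit x 0) hV hxV
  refine ⟨returnTimes T x V ∪ A, C ∪ A,
    ⟨Y, i1, i2, R, y, W, hR, hW, hy, fun n hn => Or.inl (hYsub hn)⟩, ?_, ?_⟩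
  · intro Y _ _ R hR y W hW hy
    obtain ⟨n, hn, h⟩ := hC.isDynThick.isSetOfPointwiseRecurrence Y R hR y W hW hy
    exact ⟨n, Or.inl hn, h⟩
  · rw [← Set.inter_union_distrib_right, eq_comm, Set.union_eq_right]
    exact hsub

/-! ### A set of pointwise recurrence that is not central -/

/-- The integers `n` that have the same 2-adic valuation as `⌊√n⌋`. -/
def sqrtValuationSet : Set ℕ+ := {n | padicValNat 2 n = padicValNat 2 (Nat.sqrt n)}

theorem isThick_sqrt_valuation (v n : ℕ) :
    IsThick {m : ℕ+ | padicValNat 2 (Nat.sqrt (m + n)) = v} := by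
  refine isThick_of_interval fun L => ?_
  -- A number of valuation `v` so large that `(s², s² + L + n]` contains no further square.
  set s := 2 ^ v * (2 * (L + n) + 1) with hs
  have hv : padicValNat 2 s = v := by
    rw [hs, padicValNat.mul (by positivity) (by omega), padicValNat.prime_pow,
      padicValNat.eq_zero_of_not_dvd (by omega), add_zero]
  have hsL : L + n < s := by
    have : 1 ≤ 2 ^ v := Nat.one_le_two_pow
    nlinarith
  refine ⟨s * s, fun k h1 h2 => ?_⟩
  have : Nat.sqrt (k + n) = s := by
    rw [eq_comm, Nat.eq_sqrt]
    constructor <;> nlinarith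
  change padicValNat 2 (Nat.sqrt (k + n)) = v
  rw [this, hv]

theorem padicValNat_add_of_dvd {m n : ℕ} (hn : n ≠ 0) (h : 2 ^ (padicValNat 2 n + 1) ∣ m) :
    padicValNat 2 (m + n) = padicValNat 2 n := by
  apply le_antisymm
  · by_contra hlt
    have h1 : 2 ^ (padicValNat 2 n + 1) ∣ m + n :=
      (padicValNat_dvd_iff_le (by omega)).2 (by omega)
    have h2 := (padicValNat_dvd_iff_le hn).1 ((Nat.dvd_add_right h).1 h1)
    omega
  · refine (padicValNat_dvd_iff_le (by omega)).1 (Nat.dvd_add ?_ pow_padicValNat_dvd)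
    exact (pow_dvd_pow 2 (Nat.le_succ _)).trans h

/-- Fix one return time `n`, of valuation `v`. Adding a multiple `m` of `2 ^ (v + 1)` keeps the
valuation; such `m` with `m + n` a return time are syndetic, so some `m` also gives `⌊√(m + n)⌋`
valuation `v`. -/
theorem isSetOfPointwiseRecurrence_sqrtValuationSet :
    IsSetOfPointwiseRecurrence sqrtValuationSet := by
  intro X _ _ T hT x U hU hxU
  have hx := hT.isUniformlyRecurrent x
  obtain ⟨N, hN⟩ := isSyndetic_iff.1 (hx U hU hxU)
  obtain ⟨n, -, -, hn⟩ := hN 0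
  set v := padicValNat 2 n with hv
  obtain ⟨m, ⟨hm1, hm2⟩, hm3⟩ := (hx.isSyndetic_dvd hT.2.1 (N := 2 ^ (v + 1)) (by positivity)
    (hU.preimage (hT.2.1.iterate n)) hn).inter_isThick (isThick_sqrt_valuation v n)
  have hm3 : padicValNat 2 (Nat.sqrt (m + n)) = v := hm3
  refine ⟨m + n, ?_, ?_⟩
  · change padicValNat 2 ((m + n : ℕ+) : ℕ) = padicValNat 2 (Nat.sqrt (m + n : ℕ+))
    rw [PNat.add_coe, hm3, padicValNat_add_of_dvd n.ne_zero hm1]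
  · rw [PNat.add_coe, add_comm, Function.iterate_add_apply]
    exact hm2

/-- Squares beyond `(L + 1) ^ 2` are more than `2 * L` apart, so one half of the interval avoids a
jump of the square root. -/
theorem exists_sqrt_eq_on_interval (L n : ℕ) (hn : (L + 1) ^ 2 ≤ n) :
    ∃ a s, n ≤ a ∧ a ≤ n + L ∧ ∀ k, a < k → k ≤ a + L → Nat.sqrt k = s := by
  set s := Nat.sqrt (n + 2 * L) with hs
  have h1 : s * s ≤ n + 2 * L := Nat.sqrt_le _
  have h2 : n + 2 * L < (s + 1) * (s + 1) := Nat.lt_succ_sqrt _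
  rcases Nat.lt_or_ge (n + L + 1) (s * s) with h | h
  · obtain ⟨r, hr⟩ : ∃ r, s = r + 1 := ⟨s - 1, by
      have : s ≠ 0 := by rintro h0; simp [h0] at h
      omega⟩
    rw [hr] at h h1
    have hLr : L ≤ r := by nlinarith
    refine ⟨n, r, le_rfl, by omega, fun k hk1 hk2 => ?_⟩
    rw [eq_comm, Nat.eq_sqrt]
    constructor <;> nlinarith
  · refine ⟨n + L, s, by omega, by omega, fun k hk1 hk2 => ?_⟩
    rw [eq_comm, Nat.eq_sqrt]
    constructor <;> nlinarith

/-- Where `⌊√n⌋` is constant, all return times in the set share one valuation. If one of them is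
divisible by `2 ^ g`, so is the next, although it is at most `g < 2 ^ g` away. -/
theorem not_isCentral_sqrtValuationSet : ¬ IsCentral sqrtValuationSet := by
  intro hA
  obtain ⟨X, _, _, T, x, V, C, hT, hx, hV, hxV, hC, hsub⟩ := hA.exists_inter
  obtain ⟨g, hg⟩ := isSyndetic_iff.1 (hx V hV hxV)
  obtain ⟨K, hK⟩ := isSyndetic_iff.1
    (hx.isSyndetic_dvd hT (N := 2 ^ g) (by positivity) hV hxV)
  obtain ⟨n, hn, hnC⟩ := hC.exists_interval (2 * (K + g)) ((K + g + 1) ^ 2)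
  obtain ⟨a, s, ha1, ha2, ha⟩ := exists_sqrt_eq_on_interval (K + g) n hn
  obtain ⟨m, hm1, hm2, hm3, hm4⟩ := hK a
  obtain ⟨k, hk1, hk2, hk3⟩ := hg m
  have hmA : padicValNat 2 m = padicValNat 2 (Nat.sqrt m) :=
    hsub ⟨hm4, hnC m (by omega) (by omega)⟩
  have hkA : padicValNat 2 k = padicValNat 2 (Nat.sqrt k) :=
    hsub ⟨hk3, hnC k (by omega) (by omega)⟩
  rw [ha m (by omega) (by omega)] at hmA
  rw [ha k (by omega) (by omega), ← hmA] at hkA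
  have hkd : 2 ^ g ∣ (k : ℕ) := by
    rw [padicValNat_dvd_iff_le k.ne_zero, hkA, ← padicValNat_dvd_iff_le m.ne_zero]
    exact hm3
  have h1 := Nat.le_of_dvd (by omega) (Nat.dvd_sub hkd hm3)
  have h2 : g < 2 ^ g := Nat.lt_two_pow_self
  omega

theorem isDynCentralPiecewiseSyndetic_sqrtValuationSet :
    IsDynCentralPiecewiseSyndetic sqrtValuationSet := by
  refine ⟨Set.univ, sqrtValuationSet, ?_, isSetOfPointwiseRecurrence_sqrtValuationSet,
    (Set.univ_inter _).symm⟩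
  refine ⟨Unit, inferInstance, inferInstance, id, (), Set.univ, ⟨inferInstance, continuous_id,
    fun Y hY _ _ => ?_⟩, isOpen_univ, trivial, Set.subset_univ _⟩
  obtain ⟨y, hy⟩ := hY
  exact Set.eq_univ_of_forall fun z => hy

/-! ### A piecewise syndetic set that is not dynamically central piecewise syndetic -/

theorem isPiecewiseSyndetic_odd : IsPiecewiseSyndetic {n : ℕ+ | ¬ 2 ∣ (n : ℕ)} := by
  refine ⟨1, fun F => ⟨1, fun f _ => ?_⟩⟩
  by_cases h : 2 ∣ ((f + 1 : ℕ+) : ℕ)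
  · refine Or.inr ⟨1, le_rfl, ?_⟩
    change ¬ 2 ∣ ((f + 1 + 1 : ℕ+) : ℕ)
    rw [PNat.add_coe, PNat.one_coe]
    omega
  · exact Or.inl h

/-- A uniformly recurrent point returns along even times, so the even part of `R(x, U)` is
dynamically central syndetic and `C` meets it, placing an even number in `B ∩ C`. -/
theorem not_isDynCentralPiecewiseSyndetic_odd :
    ¬ IsDynCentralPiecewiseSyndetic {n : ℕ+ | ¬ 2 ∣ (n : ℕ)} := by
  rintro ⟨B, C, ⟨X, _, _, T, x, U, hT, hU, hx, hB⟩, hC, hA⟩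
  have hur := hT.isUniformlyRecurrent x
  obtain ⟨Y, _, _, R, y, W, hR, hW, hy, hsub⟩ := isDynCentralSyndetic_of_copyTimes
    (exists_copyTimes hT.2.1 hU (m := 0) (D := {n | 2 ∣ n}) hx fun V hV hxV L => by
      obtain ⟨K, hK⟩ := isSyndetic_iff.1 (hur.isSyndetic_dvd hT.2.1 two_pos hV hxV)
      refine ⟨K, fun t => ?_⟩
      obtain ⟨q, h1, h2, h3, h4⟩ := hK t
      refine ⟨q, h1, h2, h4, fun i _ hi => ?_⟩
      have hi2 : 2 ∣ i := hi.elim (fun h => h ▸ dvd_zero 2) id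
      exact dvd_add h3 hi2)
  obtain ⟨n, hn, hny⟩ := hC Y R hR y W hW hy
  obtain ⟨-, h1, h2⟩ := hsub hny
  have h3 : n ∈ {n : ℕ+ | ¬ 2 ∣ (n : ℕ)} := hA ▸ ⟨hB h1, hn⟩
  exact h3 h2

end PointRec

theorem theoremF :
    -- strict inclusions of families (`⊂` on sets is proper inclusion)
    PointRec.centralSets ⊂ PointRec.dynCentralPiecewiseSyndeticSets ∧
    PointRec.dynCentralPiecewiseSyndeticSets ⊂ PointRec.dynPiecewiseSyndeticSets ∧
    PointRec.dynPiecewiseSyndeticSets = PointRec.piecewiseSyndeticSets ∧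
    -- in particular
    (∀ A : Set ℕ+, PointRec.IsDynPiecewiseSyndetic A ↔ PointRec.IsPiecewiseSyndetic A) ∧
    (∀ B C : Set ℕ+, PointRec.IsDynSyndetic B → PointRec.IsDynThick C →
      PointRec.IsPiecewiseSyndetic (B ∩ C)) := by
  refine ⟨?_, ?_, ?_, fun A => PointRec.isDynPiecewiseSyndetic_iff,
    fun B C hB hC => hB.inter_isDynThick hC⟩
  · refine Set.ssubset_iff_exists.2 ⟨fun A hA =>
      PointRec.IsCentral.isDynCentralPiecewiseSyndetic hA, PointRec.sqrtValuationSet,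
      PointRec.isDynCentralPiecewiseSyndetic_sqrtValuationSet,
      PointRec.not_isCentral_sqrtValuationSet⟩
  · refine Set.ssubset_iff_exists.2 ⟨fun A hA => PointRec.isDynPiecewiseSyndetic_iff.2
      (PointRec.IsDynCentralPiecewiseSyndetic.isPiecewiseSyndetic hA), _,
      PointRec.isDynPiecewiseSyndetic_iff.2 PointRec.isPiecewiseSyndetic_odd,
      PointRec.not_isDynCentralPiecewiseSyndetic_odd⟩
  · exact Set.ext fun A => PointRec.isDynPiecewiseSyndetic_iff
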